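/- For each sample size $n$ let $p=p_n$ be a positive integer, let $\Sigma^*=\Sigma^*_n$ be a positive definite $p\times p$ covariance matrix with inverse $\Omega^*$, and let $X^n=(X_1,\dots,X_n)$ be i.i.d. $N(0,\Sigma^*)$; $o_P(1)$ refers to the law of $X^n$ as $n\to\infty$. Let $\hat\Sigma=\frac1n\sum_{i=1}^nX_iX_i^T$ and $$l_n(\Omega)=\frac n2\log\det(\Omega)-\frac n2\,\mathrm{tr}(\Omega\hat\Sigma).$$ Let $\Pi=\Pi_n$ be a prior probability distribution on positive definite precision matrices $\Omega=\Sigma^{-1}$, with posterior $$\Pi(B\mid X^n)=\frac{\int_B\exp(l_n(\Omega))\,d\Pi(\Omega)}{\int\exp(l_n(\Omega))\,d\Pi(\Omega)}.$$ Write $\|\cdot\|$ for the spectral norm and $\|\cdot\|_F$ for the Frobenius norm. Let $\phi=\phi_n$ be a real (measurable) functional of the covariance matrix, $\Phi=\Phi_n$ a nonzero symmetric $p\times p$ matrix, and $A_n$ a (measurable) set of positive definite precision matrices such that $A_n\subset\{\|\Sigma-\Sigma^*\|\le\delta_n\}$ for some sequence $\delta_n=o(1)$ and $$\sup_{A_n}\sqrt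 n\,\bigl\|\Sigma^{*1/2}\Phi\Sigma^{*1/2}\bigr\|_F^{-1}\Bigl|\phi(\Sigma)-\phi(\hat\Sigma)-\mathrm{tr}\bigl((\Sigma-\hat\Sigma)\Phi\bigr)\Bigr|=o_P(1).$$ Assume $\|\Sigma^*\|\vee\|\Omega^*\|=O(1)$ and 1. $\Pi(A_n\mid X^n)=1-o_P(1)$; 2. for every fixed $t\in\mathbb R$, $$\frac{\int_{A_n}\exp(l_n(\Omega_t))\,d\Pi(\Omega)}{\int_{A_n}\exp(l_n(\Omega))\,d\Pi(\Omega)}=1+o_P(1),\qquad \Omega_t=\Omega+\frac{\sqrt2\,t}{\sqrt n\,\|\Sigma^{*1/2}\Phi\Sigma^{*1/2}\|_F}\,\Phi .$$ Then $$\sup_{t\in\mathbb R}\left|\Pi\left(\frac{\sqrt n\,\bigl(\phi(\Sigma)-\phi(\hat\Sigma)\bigr)}{\sqrt2\,\|\Sigma^{*1/2}\Phi\Sigma^{*1/2}\|_F}\le t\;\Big|\;X^n\right)-\mathbb P(Z\le t)\right|=o_P(1),\qquad Z\sim N(0,1).$$ -/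

import Mathlib

open Asymptotics MeasureTheory ProbabilityTheory Filter Topology
open scoped ENNReal

noncomputable section

namespace CovBvM

/-- The Borel `σ`-algebra on matrices, that is, the product `σ`-algebra of the entries. -/
instance matrixMeasurableSpace {p : ℕ} : MeasurableSpace (Matrix (Fin p) (Fin p) ℝ) :=
  inferInstanceAs (MeasurableSpace (Fin p → Fin p → ℝ))

/-- Spectral norm: the operator norm on Euclidean space. -/
def specNorm {p : ℕ} (M : Matrix (Fin p) (Fin p) ℝ) : ℝ :=
  ‖Matrix.toEuclideanCLM (n := Fin p) (𝕜 := ℝ) M‖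

/-- Frobenius norm. -/
def frobeniusNorm {p : ℕ} (M : Matrix (Fin p) (Fin p) ℝ) : ℝ :=
  Real.sqrt (∑ i, ∑ j, M i j ^ 2)

open scoped MatrixOrder in
/-- `‖S^{1/2} Φ S^{1/2}‖_F`, where `S^{1/2}` is the positive semidefinite square root. -/
def weightedNorm {p : ℕ} (S Φ : Matrix (Fin p) (Fin p) ℝ) : ℝ :=
  frobeniusNorm (CFC.sqrt S * Φ * CFC.sqrt S)

/-- Samples of size `n` in dimension `p`. -/
abbrev Sample (n p : ℕ) : Type := Fin n → EuclideanSpace ℝ (Fin p)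

/-- The law of `n` i.i.d. `N(0, S)` vectors. -/
def sampleLaw (n : ℕ) {p : ℕ} (S : Matrix (Fin p) (Fin p) ℝ) : Measure (Sample n p) :=
  Measure.pi fun _ : Fin n => multivariateGaussian 0 S

/-- Sample covariance (mean known to be zero): `n⁻¹ ∑ᵢ Xᵢ Xᵢᵀ`. -/
def sampleCov {n p : ℕ} (x : Sample n p) : Matrix (Fin p) (Fin p) ℝ :=
  Matrix.of fun a b => (∑ i, x i a * x i b) / (n : ℝ)

/-- Gaussian log-likelihood of the precision matrix `Ω`, up to the additive constant. -/
def logLik {n p : ℕ} (x : Sample n p) (Ω : Matrix (Fin p) (Fin p) ℝ) : ℝ :=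
  (n : ℝ) / 2 * Real.log Ω.det - (n : ℝ) / 2 * (Ω * sampleCov x).trace

/-- Posterior probability of a set `B` of precision matrices. The integrals take values in
`[0, ∞]`; if the normalizing integral is infinite (no posterior exists), the value is `0`. -/
def posteriorProb {n p : ℕ} (prior : Measure (Matrix (Fin p) (Fin p) ℝ)) (x : Sample n p)
    (B : Set (Matrix (Fin p) (Fin p) ℝ)) : ℝ :=
  ((∫⁻ Ω in B, ENNReal.ofReal (Real.exp (logLik x Ω)) ∂prior) /
    ∫⁻ Ω, ENNReal.ofReal (Real.exp (logLik x Ω)) ∂prior).toReal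

/-- The perturbed precision matrix `Ω + √2 t / (√n ‖S^{1/2} Φ S^{1/2}‖_F) Φ`. -/
def perturbed (n : ℕ) {p : ℕ} (S Φ : Matrix (Fin p) (Fin p) ℝ) (t : ℝ)
    (Ω : Matrix (Fin p) (Fin p) ℝ) : Matrix (Fin p) (Fin p) ℝ :=
  Ω + (Real.sqrt 2 * t / (Real.sqrt n * weightedNorm S Φ)) • Φ

/-- `∫_A exp(l_n(Ω_t)) dΠ(Ω) / ∫_A exp(l_n(Ω)) dΠ(Ω)`. -/
def likelihoodRatio {n p : ℕ} (prior : Measure (Matrix (Fin p) (Fin p) ℝ)) (x : Sample n p)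
    (A : Set (Matrix (Fin p) (Fin p) ℝ)) (S Φ : Matrix (Fin p) (Fin p) ℝ) (t : ℝ) : ℝ :=
  ((∫⁻ Ω in A, ENNReal.ofReal (Real.exp (logLik x (perturbed n S Φ t Ω))) ∂prior) /
    ∫⁻ Ω in A, ENNReal.ofReal (Real.exp (logLik x Ω)) ∂prior).toReal

/-- `Y n = o_P(1)` under `P n`, for `[0, ∞]`-valued quantities on a sequence of probability
spaces (in outer probability where `Y n` is not measurable). -/
def IsLittleOP {E : ℕ → Type*} [∀ n, MeasurableSpace (E n)] (P : ∀ n, Measure (E n))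
    (Y : ∀ n, E n → ℝ≥0∞) : Prop :=
  ∀ ε : ℝ≥0∞, 0 < ε → Tendsto (fun n => P n {x | ε ≤ Y n x}) atTop (𝓝 0)

end CovBvM

end

open CovBvM

open CovBvM

namespace CovBvM

/-! Fix a sample, condition the posterior on `A n`, and let T = √n (φ(Σ) − φ(Σ̂)) / (√2 w), where w
is the `weightedNorm` at Σ*. Moving Ω to Ω + sΦ with s = √2 t / (√n w) changes the log-likelihood by
tT − t²/2 up to an error that is small uniformly on `A n`. Indeed the term linear in s is t times
the linearization of T, and the quadratic term −(n/4) s² ‖Σ^{1/2} Φ Σ^{1/2}‖_F² is close to −t²/2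
because Σ is close to Σ*. The remainder bounds of `abs_logLik_perturbed_sub_le` do not involve the
dimension. The likelihood ratio condition thus says that T has exponential moments close to
exp(t²/2) under the conditioned posterior (`exp_moment_conditionalLaw_bounds`), and conditioning is
harmless since `A n` carries almost all the posterior mass.

The moment condition holds in probability for each t separately. By a compactness argument
(`exists_finset_exp_moments_close`), finitely many moments known within a fixed tolerance already
force uniform closeness of the distribution functions. The randomness of the sample then enters only
through a union bound over finitely many bad events. -/

lemma abs_log_one_add_sub_le {u : ℝ} (hu : |u| ≤ 1 / 2) :
    |Real.log (1 + u) - u + u ^ 2 / 2| ≤ 2 * |u| ^ 3 := by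
  have h := Real.abs_log_sub_add_sum_range_le (x := -u) (by rw [abs_neg]; linarith) 2
  simp only [Finset.sum_range_succ, Finset.sum_range_zero, abs_neg, sub_neg_eq_add] at h
  norm_num at h
  have h2 : |u| ^ 3 / (1 - |u|) ≤ 2 * |u| ^ 3 := by
    rw [div_le_iff₀ (by linarith)]
    nlinarith [pow_nonneg (abs_nonneg u) 3]
  refine le_trans (le_of_eq ?_) (h.trans h2)
  congr 1; ring

/-! ### Log-determinant expansion and stability of the weighted norm -/

section LinearAlgebra

variable {p : ℕ}

open Matrix Unitary in
lemma det_one_add_smul_eq_prod {M : Matrix (Fin p) (Fin p) ℝ} (hM : M.IsHermitian) (s : ℝ) :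
    (1 + s • M).det = ∏ i, (1 + s * hM.eigenvalues i) := by
  have h : 1 + s • M = conjStarAlgAut ℝ _ hM.eigenvectorUnitary
      (1 + s • diagonal (RCLike.ofReal ∘ hM.eigenvalues)) := by
    rw [map_add, map_smul, map_one, ← hM.spectral_theorem]
  rw [h, conjStarAlgAut_apply, det_mul_right_comm]
  have : 1 + s • diagonal (RCLike.ofReal ∘ hM.eigenvalues : Fin p → ℝ) =
      diagonal fun i => 1 + s * hM.eigenvalues i := by
    ext i j
    by_cases hij : i = j <;> simp [hij]
  rw [this]
  simp

open Matrix Unitary in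
lemma trace_mul_self_eq_sum {M : Matrix (Fin p) (Fin p) ℝ} (hM : M.IsHermitian) :
    (M * M).trace = ∑ i, hM.eigenvalues i ^ 2 := by
  have h : M * M = conjStarAlgAut ℝ _ hM.eigenvectorUnitary
      (diagonal (RCLike.ofReal ∘ hM.eigenvalues) * diagonal (RCLike.ofReal ∘ hM.eigenvalues)) := by
    rw [map_mul, ← hM.spectral_theorem]
  rw [h, conjStarAlgAut_apply, trace_mul_cycle]
  simp [Matrix.trace, sq]

/-- Second order expansion of `log det (1 + s M)` with an error of third order in `s‖M‖_F`. -/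
lemma abs_log_det_one_add_smul_sub_le {M : Matrix (Fin p) (Fin p) ℝ} (hM : M.IsHermitian)
    {s q : ℝ} (hq : (M * M).trace = q ^ 2) (hq0 : 0 ≤ q) (hs : |s| * q ≤ 1 / 2) :
    0 < (1 + s • M).det ∧
      |Real.log (1 + s • M).det - s * M.trace + s ^ 2 * q ^ 2 / 2| ≤ 2 * (|s| * q) ^ 3 := by
  rw [trace_mul_self_eq_sum hM] at hq
  -- Each eigenvalue is at most the Frobenius norm `q`. One factor of the cubic remainder is bounded
  -- this way and the other two sum to `q ^ 2`, so the dimension never appears.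
  have hle (i) : |s * hM.eigenvalues i| ≤ |s| * q := by
    rw [abs_mul]
    gcongr
    apply abs_le_of_sq_le_sq _ hq0
    rw [← hq]
    exact Finset.single_le_sum (f := fun i => hM.eigenvalues i ^ 2) (fun _ _ => sq_nonneg _)
      (Finset.mem_univ i)
  have hpos (i) : 0 < 1 + s * hM.eigenvalues i := by
    have := (abs_le.1 ((hle i).trans hs)).1
    linarith
  rw [det_one_add_smul_eq_prod hM]
  refine ⟨Finset.prod_pos fun i _ => hpos i, ?_⟩
  rw [Real.log_prod (fun i _ => (hpos i).ne'), hM.trace_eq_sum_eigenvalues, ← hq]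
  have e : ∑ i, Real.log (1 + s * hM.eigenvalues i) - s * ∑ i, (hM.eigenvalues i : ℝ) +
      s ^ 2 * (∑ i, hM.eigenvalues i ^ 2) / 2 =
      ∑ i, (Real.log (1 + s * hM.eigenvalues i) - s * hM.eigenvalues i +
        (s * hM.eigenvalues i) ^ 2 / 2) := by
    rw [Finset.sum_add_distrib, Finset.sum_sub_distrib, Finset.mul_sum, Finset.mul_sum,
      Finset.sum_div]
    congr 1
    exact Finset.sum_congr rfl fun i _ => by ring
  refine (congrArg abs e).trans_le ?_
  calc _ ≤ ∑ i, 2 * |s * hM.eigenvalues i| ^ 3 := (Finset.abs_sum_le_sum_abs _ _).trans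
        (Finset.sum_le_sum fun i _ => abs_log_one_add_sub_le ((hle i).trans hs))
    _ ≤ ∑ i, 2 * (|s| * q) * (s ^ 2 * hM.eigenvalues i ^ 2) := by
        refine Finset.sum_le_sum fun i _ => ?_
        rw [pow_succ, sq_abs, mul_pow]
        have := mul_le_mul_of_nonneg_left (hle i)
          (by positivity : 0 ≤ s ^ 2 * hM.eigenvalues i ^ 2)
        linarith
    _ = 2 * (|s| * q) ^ 3 := by
        rw [← Finset.mul_sum, ← Finset.mul_sum, hq, mul_pow, pow_succ |s|, sq_abs]
        ring

open scoped MatrixOrder in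
lemma sqrt_isHermitian (S : Matrix (Fin p) (Fin p) ℝ) : (CFC.sqrt S).IsHermitian :=
  (Matrix.nonneg_iff_posSemidef.1 (CFC.sqrt_nonneg S)).isHermitian

open scoped MatrixOrder in
lemma sqrt_mul_sqrt_of_posSemidef {S : Matrix (Fin p) (Fin p) ℝ} (hS : S.PosSemidef) :
    CFC.sqrt S * CFC.sqrt S = S :=
  CFC.sqrt_mul_sqrt_self S (Matrix.nonneg_iff_posSemidef.2 hS)

lemma frobeniusNorm_nonneg (M : Matrix (Fin p) (Fin p) ℝ) : 0 ≤ frobeniusNorm M :=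
  Real.sqrt_nonneg _

lemma weightedNorm_nonneg (S Φ : Matrix (Fin p) (Fin p) ℝ) : 0 ≤ weightedNorm S Φ :=
  frobeniusNorm_nonneg _

lemma frobeniusNorm_sq_of_isHermitian {M : Matrix (Fin p) (Fin p) ℝ} (hM : M.IsHermitian) :
    frobeniusNorm M ^ 2 = (M * M).trace := by
  rw [frobeniusNorm, Real.sq_sqrt (by positivity)]
  simp only [Matrix.trace, Matrix.diag_apply, Matrix.mul_apply]
  refine Finset.sum_congr rfl fun i _ => Finset.sum_congr rfl fun j _ => ?_
  have := hM.apply i j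
  simp only [star_trivial] at this
  rw [this, sq]

open scoped MatrixOrder in
lemma isHermitian_sqrt_mul_mul_sqrt {S Φ : Matrix (Fin p) (Fin p) ℝ} (hΦ : Φ.IsSymm) :
    (CFC.sqrt S * Φ * CFC.sqrt S).IsHermitian := by
  have h := sqrt_isHermitian S
  have h2 : Φ.IsHermitian := by
    rw [Matrix.IsHermitian, Matrix.conjTranspose_eq_transpose_of_trivial]; exact hΦ
  rw [Matrix.IsHermitian, Matrix.conjTranspose_mul, Matrix.conjTranspose_mul, h.eq, h2.eq,
    Matrix.mul_assoc]

open scoped MatrixOrder in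
lemma weightedNorm_sq {S Φ : Matrix (Fin p) (Fin p) ℝ} (hS : S.PosSemidef) (hΦ : Φ.IsSymm) :
    weightedNorm S Φ ^ 2 = (S * Φ * S * Φ).trace := by
  rw [weightedNorm, frobeniusNorm_sq_of_isHermitian (isHermitian_sqrt_mul_mul_sqrt hΦ)]
  have h := sqrt_mul_sqrt_of_posSemidef hS
  conv_rhs => rw [← h]
  rw [Matrix.mul_assoc, Matrix.mul_assoc, Matrix.trace_mul_comm]
  rw [Matrix.trace_mul_comm]
  simp only [Matrix.mul_assoc]
  rw [Matrix.trace_mul_comm]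
  simp only [Matrix.mul_assoc]
  rw [Matrix.trace_mul_comm]
  simp only [Matrix.mul_assoc]

open scoped MatrixOrder in
lemma trace_mul_nonneg_of_posSemidef {A B : Matrix (Fin p) (Fin p) ℝ} (hA : A.PosSemidef)
    (hB : B.PosSemidef) : 0 ≤ (A * B).trace := by
  rw [← sqrt_mul_sqrt_of_posSemidef hA, Matrix.mul_assoc, Matrix.trace_mul_comm]
  have := (hB.mul_mul_conjTranspose_same (CFC.sqrt A)).trace_nonneg
  rwa [(sqrt_isHermitian A).eq] at this

open scoped MatrixOrder in
lemma weightedNorm_pos {S Φ : Matrix (Fin p) (Fin p) ℝ} (hS : S.PosDef) (hΦ : Φ ≠ 0) :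
    0 < weightedNorm S Φ := by
  refine lt_of_le_of_ne (weightedNorm_nonneg _ _) fun h => hΦ ?_
  have hdet : IsUnit (CFC.sqrt S).det := by
    have h1 := congrArg Matrix.det (sqrt_mul_sqrt_of_posSemidef hS.posSemidef)
    rw [Matrix.det_mul] at h1
    have := hS.det_pos
    rw [isUnit_iff_ne_zero]
    rintro h0
    rw [h0] at h1
    linarith
  have hz : CFC.sqrt S * Φ * CFC.sqrt S = 0 := by
    rw [weightedNorm, frobeniusNorm, eq_comm, Real.sqrt_eq_zero (by positivity),
      Finset.sum_eq_zero_iff_of_nonneg (fun _ _ => by positivity)] at h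
    ext i j
    have := (Finset.sum_eq_zero_iff_of_nonneg (fun _ _ => by positivity)).1
      (h i (Finset.mem_univ i)) j (Finset.mem_univ j)
    simpa using this
  have h3 := congrArg (fun M => (CFC.sqrt S)⁻¹ * M * (CFC.sqrt S)⁻¹) hz
  simp only [Matrix.mul_zero, Matrix.zero_mul] at h3
  rwa [Matrix.mul_assoc, Matrix.mul_nonsing_inv_cancel_right _ _ hdet,
    Matrix.nonsing_inv_mul_cancel_left _ _ hdet] at h3

lemma abs_dotProduct_mulVec_le_specNorm (M : Matrix (Fin p) (Fin p) ℝ) (v : Fin p → ℝ) :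
    |v ⬝ᵥ (M.mulVec v)| ≤ specNorm M * (v ⬝ᵥ v) := by
  have h1 := abs_real_inner_le_norm (WithLp.toLp 2 v)
    (Matrix.toEuclideanCLM (n := Fin p) (𝕜 := ℝ) M (WithLp.toLp 2 v))
  have h2 := (Matrix.toEuclideanCLM (n := Fin p) (𝕜 := ℝ) M).le_opNorm (WithLp.toLp 2 v)
  have h3 : ‖WithLp.toLp 2 v‖ ^ 2 = v ⬝ᵥ v := by
    rw [EuclideanSpace.real_norm_sq_eq]; simp [dotProduct, sq]
  have h4 : inner ℝ (WithLp.toLp 2 v)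
      (Matrix.toEuclideanCLM (n := Fin p) (𝕜 := ℝ) M (WithLp.toLp 2 v)) = v ⬝ᵥ (M.mulVec v) := by
    rw [Matrix.toEuclideanCLM_toLp, EuclideanSpace.inner_toLp_toLp]
    simp [dotProduct_comm]
  rw [h4] at h1
  calc _ ≤ _ := h1
    _ ≤ ‖WithLp.toLp 2 v‖ * (specNorm M * ‖WithLp.toLp 2 v‖) := by gcongr; exact h2
    _ = _ := by rw [← h3]; ring

open scoped MatrixOrder in
-- This is the quadratic form bound for S⁻¹ evaluated at Rv with R = S^{1/2}: there ⟨Rv, S⁻¹Rv⟩ =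
-- ⟨v, v⟩ and ⟨Rv, Rv⟩ = ⟨v, Sv⟩.
lemma dotProduct_self_le_specNorm_inv {S : Matrix (Fin p) (Fin p) ℝ} (hS : S.PosDef)
    (v : Fin p → ℝ) : v ⬝ᵥ v ≤ specNorm S⁻¹ * (v ⬝ᵥ (S.mulVec v)) := by
  set R := CFC.sqrt S with hR
  have hRR : R * R = S := sqrt_mul_sqrt_of_posSemidef hS.posSemidef
  have hRt : R.transpose = R := by
    have := (sqrt_isHermitian S).eq
    rwa [Matrix.conjTranspose_eq_transpose_of_trivial] at this
  have hdet : IsUnit R.det := by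
    have h1 := congrArg Matrix.det hRR
    rw [Matrix.det_mul] at h1
    have := hS.det_pos
    rw [isUnit_iff_ne_zero]
    rintro h0
    rw [h0] at h1
    linarith
  have hadj (a b : Fin p → ℝ) : R.mulVec a ⬝ᵥ b = a ⬝ᵥ R.mulVec b := by
    rw [Matrix.dotProduct_mulVec, ← Matrix.mulVec_transpose, hRt]
  have h := (le_abs_self _).trans (abs_dotProduct_mulVec_le_specNorm S⁻¹ (R.mulVec v))
  rw [hadj, hadj, Matrix.mulVec_mulVec, Matrix.mulVec_mulVec, Matrix.mulVec_mulVec, hRR,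
    ← hRR, Matrix.mul_inv_rev] at h
  rw [← Matrix.mul_assoc, Matrix.mul_nonsing_inv _ hdet, Matrix.one_mul,
    Matrix.nonsing_inv_mul _ hdet, Matrix.one_mulVec] at h
  rwa [← hRR, Matrix.mul_inv_rev]

/-- Converts additive closeness in spectral norm into the multiplicative sandwich (1 − e)S ≤ T ≤ (1
+ e)S, the form that traces of products can use. -/
lemma posSemidef_add_sub_of_specNorm_le {S T : Matrix (Fin p) (Fin p) ℝ} (hS : S.PosDef)
    (hT : T.IsHermitian) {e d : ℝ} (hd : specNorm (T - S) ≤ d) (he : d * specNorm S⁻¹ ≤ e) :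
    ((1 + e) • S - T).PosSemidef ∧ (T - (1 - e) • S).PosSemidef := by
  have hd0 : 0 ≤ d := (norm_nonneg _).trans hd
  have key (v : Fin p → ℝ) :
      |v ⬝ᵥ (T.mulVec v) - v ⬝ᵥ (S.mulVec v)| ≤ e * (v ⬝ᵥ (S.mulVec v)) := by
    have h1 := abs_dotProduct_mulVec_le_specNorm (T - S) v
    rw [Matrix.sub_mulVec, dotProduct_sub] at h1
    have h0 : 0 ≤ v ⬝ᵥ v := by simpa using dotProduct_star_self_nonneg v
    have h2 : 0 ≤ v ⬝ᵥ (S.mulVec v) := by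
      simpa using hS.posSemidef.dotProduct_mulVec_nonneg v
    have h3 := dotProduct_self_le_specNorm_inv hS v
    calc _ ≤ _ := h1
      _ ≤ d * (v ⬝ᵥ v) := by gcongr
      _ ≤ d * (specNorm S⁻¹ * (v ⬝ᵥ (S.mulVec v))) := by gcongr
      _ = (d * specNorm S⁻¹) * (v ⬝ᵥ (S.mulVec v)) := by ring
      _ ≤ _ := by gcongr
  have hsmul (c : ℝ) : (c • S).IsHermitian := by
    rw [Matrix.IsHermitian, Matrix.conjTranspose_smul, hS.isHermitian.eq, star_trivial]
  constructor
  · refine Matrix.PosSemidef.of_dotProduct_mulVec_nonneg ((hsmul _).sub hT) fun v => ?_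
    have := (abs_le.1 (key v)).2
    rw [star_trivial, Matrix.sub_mulVec, Matrix.smul_mulVec, dotProduct_sub, dotProduct_smul,
      smul_eq_mul]
    linarith
  · refine Matrix.PosSemidef.of_dotProduct_mulVec_nonneg (hT.sub (hsmul _)) fun v => ?_
    have := (abs_le.1 (key v)).1
    rw [star_trivial, Matrix.sub_mulVec, Matrix.smul_mulVec, dotProduct_sub, dotProduct_smul,
      smul_eq_mul]
    linarith

lemma posSemidef_mul_mul_self {S Φ : Matrix (Fin p) (Fin p) ℝ} (hS : S.PosSemidef)
    (hΦ : Φ.IsSymm) : (Φ * S * Φ).PosSemidef := by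
  have := hS.mul_mul_conjTranspose_same Φ
  rwa [Matrix.conjTranspose_eq_transpose_of_trivial, hΦ] at this

/-- In tr(TΦTΦ) the two factors T are exchanged for S one at a time, each exchange costing a factor
between 1 − e and 1 + e, since the trace of a product of positive semidefinite matrices is
nonnegative. For e ≤ 1 both (1 + e)² − 1 and 1 − (1 − e)² are at most 3e. -/
lemma abs_weightedNorm_sq_sub_le {S T Φ : Matrix (Fin p) (Fin p) ℝ} (hS : S.PosDef)
    (hT : T.PosDef) (hΦ : Φ.IsSymm) {e d : ℝ} (hd : specNorm (T - S) ≤ d)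
    (he : d * specNorm S⁻¹ ≤ e) (he1 : e ≤ 1) :
    |weightedNorm T Φ ^ 2 - weightedNorm S Φ ^ 2| ≤ 3 * e * weightedNorm S Φ ^ 2 := by
  have he0 : 0 ≤ e := (mul_nonneg ((norm_nonneg _).trans hd) (norm_nonneg _)).trans he
  obtain ⟨hu, hl⟩ := posSemidef_add_sub_of_specNorm_le hS hT.isHermitian hd he
  rw [weightedNorm_sq hS.posSemidef hΦ, weightedNorm_sq hT.posSemidef hΦ]
  have c : (T * Φ * S * Φ).trace = (S * Φ * T * Φ).trace := by
    rw [Matrix.mul_assoc, Matrix.trace_mul_comm, ← Matrix.mul_assoc]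
  have e1 := trace_mul_nonneg_of_posSemidef hu (posSemidef_mul_mul_self hT.posSemidef hΦ)
  have e2 := trace_mul_nonneg_of_posSemidef hu (posSemidef_mul_mul_self hS.posSemidef hΦ)
  have e3 := trace_mul_nonneg_of_posSemidef hl (posSemidef_mul_mul_self hT.posSemidef hΦ)
  have e4 := trace_mul_nonneg_of_posSemidef hl (posSemidef_mul_mul_self hS.posSemidef hΦ)
  have e5 := trace_mul_nonneg_of_posSemidef hS.posSemidef
    (posSemidef_mul_mul_self hS.posSemidef hΦ)
  simp only [Matrix.sub_mul, Matrix.smul_mul, Matrix.trace_sub, Matrix.trace_smul, smul_eq_mul,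
    ← Matrix.mul_assoc] at e1 e2 e3 e4 e5
  rw [c] at e2 e4
  rw [abs_le]
  constructor <;> nlinarith

end LinearAlgebra

/-! ### Local expansion of the Gaussian likelihood -/

section Likelihood

variable {n p : ℕ}

open scoped MatrixOrder in
-- With R the root of Ω⁻¹ one has RΩR = 1. Conjugating by R, instead of factoring out Ω on one side,
-- keeps the perturbation symmetric, so its eigenvalues are real and the spectral expansion applies.
lemma det_add_smul_eq {Ω Φ : Matrix (Fin p) (Fin p) ℝ} (hΩ : Ω.PosDef) (s : ℝ) :
    (Ω + s • Φ).det = Ω.det * (1 + s • (CFC.sqrt Ω⁻¹ * Φ * CFC.sqrt Ω⁻¹)).det := by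
  set R := CFC.sqrt Ω⁻¹ with hR
  have hRR : R * R = Ω⁻¹ := sqrt_mul_sqrt_of_posSemidef hΩ.inv.posSemidef
  have hdet : IsUnit R.det := by
    have h1 := congrArg Matrix.det hRR
    rw [Matrix.det_mul] at h1
    have := hΩ.inv.det_pos
    rw [isUnit_iff_ne_zero]
    rintro h0
    rw [h0] at h1
    linarith
  have hu : IsUnit Ω.det := isUnit_iff_ne_zero.2 hΩ.det_pos.ne'
  have hO : R * Ω * R = 1 := by
    have h1 : Ω = R⁻¹ * R⁻¹ := by
      rw [← Matrix.mul_inv_rev, hRR, Matrix.nonsing_inv_nonsing_inv _ hu]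
    rw [h1, ← Matrix.mul_assoc, Matrix.mul_nonsing_inv _ hdet, Matrix.one_mul,
      Matrix.nonsing_inv_mul _ hdet]
  have h2 : 1 + s • (R * Φ * R) = R * (Ω + s • Φ) * R := by
    rw [Matrix.mul_add, Matrix.add_mul, hO, Matrix.mul_smul, Matrix.smul_mul]
  have h3 := congrArg Matrix.det hO
  rw [Matrix.det_mul, Matrix.det_mul, Matrix.det_one] at h3
  rw [h2, Matrix.det_mul, Matrix.det_mul]
  linear_combination (-(Ω + s • Φ).det) * h3

open scoped MatrixOrder in
/-- Local asymptotic expansion of the Gaussian log-likelihood in the direction `Φ`. -/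
lemma abs_logLik_perturbed_sub_le {x : Sample n p} (hn : 0 < n)
    {S Ω Φ : Matrix (Fin p) (Fin p) ℝ} (hS : S.PosDef) (hΩ : Ω.PosDef) (hΦ : Φ.IsSymm)
    (hΦ0 : Φ ≠ 0) {e d : ℝ} (hd : specNorm (Ω⁻¹ - S) ≤ d) (he : d * specNorm S⁻¹ ≤ e)
    (he1 : e ≤ 1) {t : ℝ} (ht : 2 * (Real.sqrt 2 * |t|) / Real.sqrt n ≤ 1 / 2) :
    |logLik x (perturbed n S Φ t Ω) - logLik x Ω -
        Real.sqrt n * t / (Real.sqrt 2 * weightedNorm S Φ) * ((Ω⁻¹ - sampleCov x) * Φ).trace +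
        t ^ 2 / 2| ≤
      8 * (Real.sqrt 2 * |t|) ^ 3 / Real.sqrt n + 3 * e * t ^ 2 / 2 := by
  have hw := weightedNorm_pos hS hΦ0
  set w := weightedNorm S Φ with hwdef
  set q := weightedNorm Ω⁻¹ Φ with hqdef
  have hq0 : 0 ≤ q := weightedNorm_nonneg _ _
  have hqw := abs_weightedNorm_sq_sub_le hS hΩ.inv hΦ hd he he1
  rw [← hwdef, ← hqdef] at hqw
  -- From q² ≤ (1 + 3e) w² and e ≤ 1.
  have hq2w : q ≤ 2 * w := by
    apply le_of_sq_le_sq _ (by positivity)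
    have := (abs_le.1 hqw).2
    nlinarith [sq_nonneg w]
  have hr : 0 < Real.sqrt n := by positivity
  have hrr : Real.sqrt n ^ 2 = n := Real.sq_sqrt (by positivity)
  have h22 : Real.sqrt 2 ^ 2 = 2 := Real.sq_sqrt (by positivity)
  have h2 : 0 < Real.sqrt 2 := by positivity
  set r := Real.sqrt n with hrdef
  set s := Real.sqrt 2 * t / (r * w) with hs
  have hsw : s * w = Real.sqrt 2 * t / r := by rw [hs]; field_simp
  have habs : |s| * w = Real.sqrt 2 * |t| / r := by
    have := congrArg abs hsw
    rwa [abs_mul, abs_of_pos hw, abs_div (_ * _) r, abs_mul, abs_of_pos h2, abs_of_pos hr] at this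
  have hsq : |s| * q ≤ 2 * (Real.sqrt 2 * |t|) / r := by
    calc |s| * q ≤ |s| * (2 * w) := by gcongr
      _ = 2 * (|s| * w) := by ring
      _ = _ := by rw [habs]; ring
  have hM := isHermitian_sqrt_mul_mul_sqrt (S := Ω⁻¹) hΦ
  obtain ⟨hpos, hexp⟩ := abs_log_det_one_add_smul_sub_le hM (s := s) (q := q)
    (frobeniusNorm_sq_of_isHermitian hM).symm hq0 (hsq.trans ht)
  have htr : (CFC.sqrt Ω⁻¹ * Φ * CFC.sqrt Ω⁻¹).trace = (Ω⁻¹ * Φ).trace := by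
    rw [Matrix.trace_mul_comm, ← Matrix.mul_assoc,
      sqrt_mul_sqrt_of_posSemidef hΩ.inv.posSemidef]
  rw [htr] at hexp
  have hlog : Real.log (perturbed n S Φ t Ω).det = Real.log Ω.det +
      Real.log (1 + s • (CFC.sqrt Ω⁻¹ * Φ * CFC.sqrt Ω⁻¹)).det := by
    rw [← Real.log_mul hΩ.det_pos.ne' hpos.ne', ← det_add_smul_eq hΩ]
    rfl
  have htp : (perturbed n S Φ t Ω * sampleCov x).trace =
      (Ω * sampleCov x).trace + s * (sampleCov x * Φ).trace := by
    rw [Matrix.trace_mul_comm (sampleCov x) Φ]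
    simp only [perturbed, Matrix.add_mul, Matrix.smul_mul, Matrix.trace_add, Matrix.trace_smul,
      smul_eq_mul]
    rfl
  set L := Real.log (1 + s • (CFC.sqrt Ω⁻¹ * Φ * CFC.sqrt Ω⁻¹)).det with hL
  rw [logLik, logLik, hlog, htp, Matrix.sub_mul, Matrix.trace_sub]
  have hc : r * t / (Real.sqrt 2 * w) = n / 2 * s := by
    rw [hs, ← hrr]
    field_simp
    rw [h22]
  have ht2 : t ^ 2 / 2 = n / 4 * (s * w) ^ 2 := by
    rw [hsw, div_pow, mul_pow, h22, hrr]
    field_simp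
    norm_num
  -- The main terms cancel exactly. What remains is the cubic remainder of the log-determinant and
  -- the cost of having Σ in place of Σ* in the quadratic term.
  have hid : (n : ℝ) / 2 * (Real.log Ω.det + L) -
      n / 2 * ((Ω * sampleCov x).trace + s * (sampleCov x * Φ).trace) -
      (n / 2 * Real.log Ω.det - n / 2 * (Ω * sampleCov x).trace) -
      r * t / (Real.sqrt 2 * w) * ((Ω⁻¹ * Φ).trace - (sampleCov x * Φ).trace) + t ^ 2 / 2 =
      n / 2 * (L - s * (Ω⁻¹ * Φ).trace + s ^ 2 * q ^ 2 / 2) - n / 4 * s ^ 2 * (q ^ 2 - w ^ 2) := by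
    rw [hc, ht2]; ring
  rw [hid]
  refine (abs_sub _ _).trans (add_le_add ?_ ?_)
  · rw [abs_mul, abs_of_nonneg (by positivity : (0 : ℝ) ≤ n / 2)]
    calc (n : ℝ) / 2 * _ ≤ n / 2 * (2 * (|s| * q) ^ 3) := by gcongr
      _ ≤ n / 2 * (2 * (2 * (Real.sqrt 2 * |t|) / r) ^ 3) := by gcongr
      _ = _ := by rw [← hrr]; field_simp; ring
  · rw [abs_mul, abs_of_nonneg (by positivity : (0 : ℝ) ≤ n / 4 * s ^ 2)]
    calc (n : ℝ) / 4 * s ^ 2 * |q ^ 2 - w ^ 2| ≤ n / 4 * s ^ 2 * (3 * e * w ^ 2) := by gcongr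
      _ = 3 * e * (n / 4 * (s * w) ^ 2) := by ring
      _ = _ := by rw [← ht2]; ring

end Likelihood

/-! ### From exponential moments to the normal distribution function -/

section MomentGenerating

open Set

/-- The exponential truncated at level `L`, as a bounded continuous function. -/
noncomputable def truncatedExp (t : ℝ) (L : NNReal) : BoundedContinuousFunction ℝ NNReal :=
  BoundedContinuousFunction.mkOfBound
    ⟨fun x => min (Real.exp (t * x)).toNNReal L, by fun_prop⟩ L fun x y => by
      rw [NNReal.dist_eq, abs_sub_le_iff]
      have hx : ((min (Real.exp (t * x)).toNNReal L : NNReal) : ℝ) ≤ L :=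
        NNReal.coe_le_coe.2 (min_le_right _ _)
      have hy : ((min (Real.exp (t * y)).toNNReal L : NNReal) : ℝ) ≤ L :=
        NNReal.coe_le_coe.2 (min_le_right _ _)
      have hx0 := NNReal.coe_nonneg (min (Real.exp (t * x)).toNNReal L)
      have hy0 := NNReal.coe_nonneg (min (Real.exp (t * y)).toNNReal L)
      constructor <;> simp only [ContinuousMap.coe_mk] <;> linarith

lemma truncatedExp_le (t : ℝ) (L : NNReal) (x : ℝ) :
    (truncatedExp t L x : ℝ≥0∞) ≤ ENNReal.ofReal (Real.exp (t * x)) :=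
  ENNReal.coe_le_coe.2 (min_le_left _ _)

/-- Where a = exp(tx) exceeds L, a ≤ a²/L. Hence the moment at 2t gives uniform integrability for
the moment at t. -/
lemma exp_le_truncatedExp_add (t : ℝ) {L : NNReal} (hL : 0 < L) (x : ℝ) :
    ENNReal.ofReal (Real.exp (t * x)) ≤
      truncatedExp t L x + (L : ℝ≥0∞)⁻¹ * ENNReal.ofReal (Real.exp (2 * t * x)) := by
  set a : NNReal := (Real.exp (t * x)).toNNReal with ha
  have h2 : ENNReal.ofReal (Real.exp (2 * t * x)) = (a * a : NNReal) := by
    rw [ha, ← Real.toNNReal_mul (Real.exp_pos _).le, ← Real.exp_add]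
    rw [show t * x + t * x = 2 * t * x by ring]; rfl
  have h1 : truncatedExp t L x = min a L := rfl
  rw [h2, h1, show ENNReal.ofReal (Real.exp (t * x)) = (a : ℝ≥0∞) from rfl]
  rw [← ENNReal.coe_inv hL.ne']
  norm_cast
  rcases le_total a L with h | h
  · rw [min_eq_left h]; exact le_self_add
  · refine le_trans ?_ le_add_self
    rw [← mul_assoc]
    refine le_mul_of_one_le_left zero_le ?_
    rw [← inv_mul_cancel₀ hL.ne']
    gcongr

lemma lintegral_exp_le_truncatedExp_add (μ : Measure ℝ) (t : ℝ) {L : NNReal} (hL : 0 < L) :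
    ∫⁻ x, ENNReal.ofReal (Real.exp (t * x)) ∂μ ≤
      ∫⁻ x, truncatedExp t L x ∂μ +
        (L : ℝ≥0∞)⁻¹ * ∫⁻ x, ENNReal.ofReal (Real.exp (2 * t * x)) ∂μ := by
  rw [← lintegral_const_mul _ (by fun_prop), ← lintegral_add_right _ (by fun_prop)]
  exact lintegral_mono fun x => exp_le_truncatedExp_add t hL x

/-- Exponential moments pass to weak limits when they converge to finite values. -/
lemma lintegral_exp_eq_of_tendsto {ι : Type*} {l : Filter ι} [l.NeBot]
    {μ : ι → ProbabilityMeasure ℝ} {ν : ProbabilityMeasure ℝ} (hμ : Tendsto μ l (𝓝 ν))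
    {m : ℝ → ℝ≥0∞} (hm : ∀ t, m t ≠ ∞)
    (h : ∀ t, Tendsto (fun i => ∫⁻ x, ENNReal.ofReal (Real.exp (t * x)) ∂(μ i : Measure ℝ)) l
      (𝓝 (m t))) (t : ℝ) :
    ∫⁻ x, ENNReal.ofReal (Real.exp (t * x)) ∂(ν : Measure ℝ) = m t := by
  have hc (t : ℝ) (L : NNReal) :=
    (ProbabilityMeasure.tendsto_iff_forall_lintegral_tendsto.1 hμ) (truncatedExp t L)
  have hinv (c : ℝ≥0∞) (hcf : c ≠ ∞) (a : ℝ≥0∞) :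
      Tendsto (fun k : ℕ => a + (((k + 1 : ℕ) : NNReal) : ℝ≥0∞)⁻¹ * c) atTop (𝓝 a) := by
    have h1 : Tendsto (fun k : ℕ => (((k + 1 : ℕ) : NNReal) : ℝ≥0∞)⁻¹) atTop (𝓝 0) := by
      have := (tendsto_add_atTop_iff_nat 1).2 ENNReal.tendsto_inv_nat_nhds_zero
      simpa only [ENNReal.coe_natCast] using this
    have h2 := ENNReal.Tendsto.mul_const h1 (Or.inr hcf)
    simpa using tendsto_const_nhds.add h2
  -- Fatou direction: truncated moments pass to the limit, then monotone convergence in the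
  -- truncation level.
  have hle (t : ℝ) : ∫⁻ x, ENNReal.ofReal (Real.exp (t * x)) ∂(ν : Measure ℝ) ≤ m t := by
    have key (L : NNReal) : ∫⁻ x, truncatedExp t L x ∂(ν : Measure ℝ) ≤ m t :=
      le_of_tendsto_of_tendsto (hc t L) (h t)
        (Eventually.of_forall fun i => lintegral_mono fun x => truncatedExp_le t L x)
    have hmono : ∫⁻ x, ENNReal.ofReal (Real.exp (t * x)) ∂(ν : Measure ℝ) =
        ⨆ k : ℕ, ∫⁻ x, truncatedExp t (k : NNReal) x ∂(ν : Measure ℝ) := by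
      rw [← lintegral_iSup (fun k => by fun_prop)]
      · refine lintegral_congr fun x => le_antisymm ?_ (iSup_le fun k => truncatedExp_le _ _ _)
        obtain ⟨k, hk⟩ := exists_nat_ge (Real.exp (t * x)).toNNReal
        refine le_iSup_of_le k (ENNReal.coe_le_coe.2 ?_)
        exact le_min le_rfl hk
      · intro k l hkl x
        refine ENNReal.coe_le_coe.2 (min_le_min le_rfl ?_)
        exact_mod_cast hkl
    rw [hmono]
    exact iSup_le fun k => key k
  refine le_antisymm (hle t) ?_
  have key (L : NNReal) (hL : 0 < L) : m t ≤
      ∫⁻ x, ENNReal.ofReal (Real.exp (t * x)) ∂(ν : Measure ℝ) + (L : ℝ≥0∞)⁻¹ * m (2 * t) := by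
    have h1 : m t ≤ ∫⁻ x, truncatedExp t L x ∂(ν : Measure ℝ) + (L : ℝ≥0∞)⁻¹ * m (2 * t) := by
      refine le_of_tendsto_of_tendsto (h t) ((hc t L).add (ENNReal.Tendsto.const_mul (h (2 * t))
        (Or.inr ?_))) (Eventually.of_forall fun i => lintegral_exp_le_truncatedExp_add _ t hL)
      simp [hL.ne']
    exact h1.trans (add_le_add_left (lintegral_mono fun x => truncatedExp_le t L x) _)
  exact ge_of_tendsto' (hinv _ (hm _) _) fun k => key _ (by positivity)

lemma lintegral_exp_gaussianReal (t : ℝ) :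
    ∫⁻ x, ENNReal.ofReal (Real.exp (t * x)) ∂(gaussianReal 0 1) =
      ENNReal.ofReal (Real.exp (t ^ 2 / 2)) := by
  have h := congrFun (mgf_id_gaussianReal (μ := 0) (v := 1)) t
  have hi : Integrable (fun x => Real.exp (t * x)) (gaussianReal 0 1) := by
    -- A nonintegrable exponential would have Bochner integral 0, so positivity of the moment gives
    -- integrability.
    have := mgf_pos_iff (X := id) (μ := gaussianReal 0 1) (t := t)
    exact this.1 (by rw [h]; positivity)
  rw [← ofReal_integral_eq_lintegral_ofReal hi (Eventually.of_forall fun _ => (Real.exp_pos _).le)]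
  congr 1
  simpa [mgf] using h

/-- A probability measure with the exponential moments of the standard normal law is
standard normal. -/
lemma eq_gaussianReal_of_lintegral_exp {ν : Measure ℝ} [IsProbabilityMeasure ν]
    (h : ∀ t : ℝ, ∫⁻ x, ENNReal.ofReal (Real.exp (t * x)) ∂ν =
      ENNReal.ofReal (Real.exp (t ^ 2 / 2))) : ν = gaussianReal 0 1 := by
  have hint (ν : Measure ℝ) (h : ∀ t : ℝ, ∫⁻ x, ENNReal.ofReal (Real.exp (t * x)) ∂ν =
      ENNReal.ofReal (Real.exp (t ^ 2 / 2))) (t : ℝ) :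
      Integrable (fun x => Real.exp (t * x)) ν := by
    refine ⟨by fun_prop, ?_⟩
    rw [hasFiniteIntegral_iff_ofReal (Eventually.of_forall fun _ => (Real.exp_pos _).le), h]
    exact ENNReal.ofReal_lt_top
  have hm : mgf id ν = mgf id (gaussianReal 0 1) := by
    ext t
    simp only [mgf, id]
    rw [integral_eq_lintegral_of_nonneg_ae (Eventually.of_forall fun _ => (Real.exp_pos _).le)
      (by fun_prop), integral_eq_lintegral_of_nonneg_ae
      (Eventually.of_forall fun _ => (Real.exp_pos _).le) (by fun_prop), h,
      lintegral_exp_gaussianReal]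
  -- Moments are finite at every real t, so agreement on the real axis extends to the whole complex
  -- plane, and there the complex moment generating function determines the measure.
  refine Measure.ext_of_complexMGF_id_eq ?_
  have huniv : integrableExpSet id ν = univ := eq_univ_of_forall fun t => hint ν h t
  ext z
  exact eqOn_complexMGF_of_mgf hm (by simp [huniv])

/-- Chernoff bound on both tails; it supplies tightness. -/
lemma measure_compl_Icc_le_exp (μ : Measure ℝ) (R : ℝ) :
    μ (Icc (-R) R)ᶜ ≤ ENNReal.ofReal (Real.exp (-R)) *
      (∫⁻ x, ENNReal.ofReal (Real.exp (1 * x)) ∂μ +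
        ∫⁻ x, ENNReal.ofReal (Real.exp (-1 * x)) ∂μ) := by
  rw [← lintegral_add_left (by fun_prop), ← lintegral_const_mul _ (by fun_prop),
    ← lintegral_indicator_one measurableSet_Icc.compl]
  refine lintegral_mono fun x => ?_
  by_cases hy : x ∈ (Icc (-R) R)ᶜ
  swap
  · rw [indicator_of_notMem hy]; exact zero_le
  rw [indicator_of_mem hy]
  rw [← ENNReal.ofReal_add (by positivity) (by positivity), ← ENNReal.ofReal_mul (by positivity),
    Pi.one_apply, ← ENNReal.ofReal_one]
  refine ENNReal.ofReal_le_ofReal ?_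
  rw [mul_add, ← Real.exp_add, ← Real.exp_add]
  simp only [mem_compl_iff, mem_Icc, not_and_or, not_le] at hy
  rcases hy with hy | hy
  · have := Real.one_le_exp (x := -R + -1 * x) (by linarith)
    linarith [Real.exp_pos (-R + 1 * x)]
  · have := Real.one_le_exp (x := -R + 1 * x) (by linarith)
    linarith [Real.exp_pos (-R + -1 * x)]

/-- Convergence of exponential moments to those of the standard normal law implies weak
convergence along an ultrafilter. -/
lemma tendsto_gaussianReal_of_tendsto_lintegral_exp {ι : Type*} (l : Ultrafilter ι)
    {μ : ι → ProbabilityMeasure ℝ}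
    (h : ∀ t, Tendsto (fun i => ∫⁻ x, ENNReal.ofReal (Real.exp (t * x)) ∂(μ i : Measure ℝ)) l
      (𝓝 (ENNReal.ofReal (Real.exp (t ^ 2 / 2))))) :
    Tendsto μ l (𝓝 (⟨gaussianReal 0 1, inferInstance⟩ : ProbabilityMeasure ℝ)) := by
  -- Strictly above the limit 2 exp(1/2) of the sum of the moments at 1 and −1, hence eventually an
  -- upper bound for that sum.
  set C : ℝ := 2 * Real.exp (1 / 2) + 1 with hC
  have hCpos : 0 < C := by positivity
  set u : ℕ → NNReal := fun n => (Real.exp (-n) * C).toNNReal with hu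
  have hu0 : Tendsto u atTop (𝓝 0) := by
    have h1 : Tendsto (fun n : ℕ => Real.exp (-n) * C) atTop (𝓝 (0 * C)) :=
      (Real.tendsto_exp_neg_atTop_nhds_zero.comp tendsto_natCast_atTop_atTop).mul_const C
    have := (continuous_real_toNNReal.tendsto _).comp h1
    simpa [Function.comp_def] using this
  have hK := isCompact_setOfPred_probabilityMeasure_mass_eq_compl_isCompact_le (E := ℝ) hu0
    (K := fun n : ℕ => Icc (-(n : ℝ)) n) (fun n => isCompact_Icc) (Or.inl inferInstance)
  have hev : ∀ᶠ i in (l : Filter ι), μ i ∈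
      {μ : ProbabilityMeasure ℝ | ∀ n : ℕ, μ (Icc (-(n : ℝ)) n)ᶜ ≤ u n} := by
    have hsum := (h 1).add (h (-1))
    rw [← ENNReal.ofReal_add (by positivity) (by positivity)] at hsum
    have hlt : ENNReal.ofReal (Real.exp (1 ^ 2 / 2) + Real.exp ((-1) ^ 2 / 2)) <
        ENNReal.ofReal C := by
      rw [ENNReal.ofReal_lt_ofReal_iff hCpos, hC]
      norm_num
      linarith
    filter_upwards [hsum.eventually (gt_mem_nhds hlt)] with i hi n
    rw [← ENNReal.coe_le_coe, ProbabilityMeasure.ennreal_coeFn_eq_coeFn_toMeasure]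
    refine (measure_compl_Icc_le_exp _ _).trans ?_
    calc _ ≤ ENNReal.ofReal (Real.exp (-n)) * ENNReal.ofReal C := by gcongr
      _ = _ := by rw [← ENNReal.ofReal_mul (by positivity)]; rfl
  -- Prokhorov: the tight family is compact, so the ultrafilter has a limit, which its exponential
  -- moments then identify.
  obtain ⟨ν, -, hν⟩ := isCompact_iff_ultrafilter_le_nhds.1 hK (l.map μ) (le_principal_iff.2 hev)
  have hν' : Tendsto μ l (𝓝 ν) := hν
  have := eq_gaussianReal_of_lintegral_exp (ν := ν) fun t =>
    lintegral_exp_eq_of_tendsto hν' (m := fun t => ENNReal.ofReal (Real.exp (t ^ 2 / 2)))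
      (fun _ => ENNReal.ofReal_ne_top) h t
  have hνeq : ν = ⟨gaussianReal 0 1, inferInstance⟩ := Subtype.ext this
  rwa [hνeq] at hν'

lemma continuous_cdf_of_nullSingletonClass (μ : Measure ℝ) [IsProbabilityMeasure μ]
    [NullSingletonClass μ] :
    Continuous (cdf μ) := by
  rw [continuous_iff_continuousAt]
  intro x
  rw [(monotone_cdf μ).continuousAt_iff_leftLim_eq_rightLim, StieltjesFunction.rightLim_eq]
  refine le_antisymm ((monotone_cdf μ).leftLim_le le_rfl) ?_
  have h := (cdf μ).measure_singleton x
  rw [measure_cdf, measure_singleton] at h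
  have := ENNReal.ofReal_eq_zero.1 h.symm
  linarith

/-- Closeness of a distribution function to a continuous one on a suitable finite set implies
uniform closeness. -/
lemma exists_finset_forall_abs_cdf_sub_le (γ : Measure ℝ) [IsProbabilityMeasure γ]
    [NullSingletonClass γ] {ε : ℝ} (hε : 0 < ε) :
    ∃ X : Finset ℝ, ∃ κ > 0, ∀ (μ : Measure ℝ) [IsProbabilityMeasure μ],
      (∀ x ∈ X, |μ.real (Iic x) - γ.real (Iic x)| ≤ κ) →
        ∀ t, |μ.real (Iic t) - γ.real (Iic t)| ≤ ε := by
  -- Of the error 3/N, one part is the tolerance at the grid points and two are spacing of the grid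
  -- of quantiles.
  obtain ⟨N, hN⟩ := exists_nat_gt (3 / ε)
  have hN0 : (0 : ℝ) < N := (by positivity : 0 < 3 / ε).trans hN
  have hNε : 3 / (N : ℝ) < ε := by
    rw [div_lt_iff₀ hε] at hN
    rw [div_lt_iff₀ hN0]; linarith
  have hex (j : ℕ) (hj : 0 < j) (hjN : j < N) : ∃ x, γ.real (Iic x) = j / N := by
    have h0 : (0 : ℝ) < j / N := by positivity
    have h1 : (j : ℝ) / N < 1 := by rw [div_lt_one hN0]; exact_mod_cast hjN
    obtain ⟨a, ha⟩ := ((tendsto_cdf_atBot γ).eventually (gt_mem_nhds h0)).exists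
    obtain ⟨b, hb⟩ := ((tendsto_cdf_atTop γ).eventually (lt_mem_nhds h1)).exists
    obtain ⟨x, hx⟩ := mem_range_of_exists_le_of_exists_ge (continuous_cdf_of_nullSingletonClass γ)
      ⟨a, ha.le⟩ ⟨b, hb.le⟩
    exact ⟨x, by rw [← cdf_eq_real, hx]⟩
  choose! g hg using hex
  refine ⟨(Finset.Ioo 0 N).image g, 1 / N, by positivity, fun μ _ hX t => ?_⟩
  have hXj (j : ℕ) (h0 : 0 < j) (hjN : j < N) : |μ.real (Iic (g j)) - j / N| ≤ 1 / N := by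
    rw [← hg j h0 hjN]
    exact hX _ (Finset.mem_image_of_mem _ (Finset.mem_Ioo.2 ⟨h0, hjN⟩))
  have hmono (ρ : Measure ℝ) [IsProbabilityMeasure ρ] {a b : ℝ} (hab : a ≤ b) :
      ρ.real (Iic a) ≤ ρ.real (Iic b) := measureReal_mono (Iic_subset_Iic.2 hab)
  set v := γ.real (Iic t) with hv
  have hv0 : 0 ≤ v := measureReal_nonneg
  have hv1 : v ≤ 1 := measureReal_le_one
  set j := ⌊N * v⌋₊ with hj
  have hj1 : (j : ℝ) ≤ N * v := Nat.floor_le (by positivity)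
  have hj2 : N * v < j + 1 := Nat.lt_floor_add_one _
  have hj1' : (j : ℝ) / N ≤ v := by rw [div_le_iff₀ hN0]; linarith
  have hj2' : v < (j + 1) / N := by rw [lt_div_iff₀ hN0]; linarith
  have e3 : 3 / (N : ℝ) = 1 / N + 1 / N + 1 / N := by ring
  rw [abs_le]
  constructor
  -- The index `j - 1` replaces `j` because its level is strictly below `v`, which forces `g (j - 1)
  -- ≤ t` without strict monotonicity of the distribution function. If `j ≤ 1` then v < 2/N and
  -- nonnegativity suffices.
  · by_cases hj0 : 2 ≤ j
    · have hjN : j - 1 < N := by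
        have : (j : ℝ) ≤ N := hj1.trans (by nlinarith)
        have : j ≤ N := by exact_mod_cast this
        omega
      have hxt : g (j - 1) ≤ t := by
        by_contra! hlt
        have := hmono γ hlt.le
        rw [hg _ (by omega) hjN, ← hv, Nat.cast_sub (by omega), Nat.cast_one, sub_div] at this
        have : 0 < 1 / (N : ℝ) := by positivity
        linarith
      have h1 := (abs_le.1 (hXj (j - 1) (by omega) hjN)).1
      have h2 := hmono μ hxt
      rw [Nat.cast_sub (by omega), Nat.cast_one, sub_div] at h1
      rw [add_div] at hj2'
      linarith
    · have hj3 : (j : ℝ) ≤ 1 := by exact_mod_cast (by omega : j ≤ 1)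
      have : ((j : ℝ) + 1) / N ≤ 1 / N + 1 / N := by rw [← add_div]; gcongr
      have : 0 ≤ μ.real (Iic t) := measureReal_nonneg
      have : 0 < 1 / (N : ℝ) := by positivity
      linarith
  · by_cases hjN : j + 1 < N
    · have hxt : t ≤ g (j + 1) := by
        by_contra! hlt
        have := hmono γ hlt.le
        rw [hg _ (by omega) hjN, ← hv] at this
        push_cast at this
        linarith
      have h1 := (abs_le.1 (hXj (j + 1) (by omega) hjN)).2
      have h2 := hmono μ hxt
      push_cast at h1
      rw [add_div] at h1
      have : 0 < 1 / (N : ℝ) := by positivity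
      linarith
    · have hj3 : (N : ℝ) ≤ j + 1 := by exact_mod_cast (by omega : N ≤ j + 1)
      have : 1 ≤ ((j : ℝ) + 1) / N := by rw [le_div_iff₀ hN0]; linarith
      have h1 : μ.real (Iic t) ≤ 1 := measureReal_le_one
      rw [add_div] at this
      have : 0 < 1 / (N : ℝ) := by positivity
      linarith

/-- Uniform closeness to the standard normal distribution function is controlled by finitely many
exponential moments. -/
theorem exists_finset_exp_moments_close (ε : ℝ) (hε : 0 < ε) :
    ∃ F : Finset ℝ, ∃ η > 0, ∀ (μ : Measure ℝ) [IsProbabilityMeasure μ],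
      (∀ t ∈ F, ENNReal.ofReal (Real.exp (t ^ 2 / 2 - η)) ≤
          ∫⁻ x, ENNReal.ofReal (Real.exp (t * x)) ∂μ ∧
        ∫⁻ x, ENNReal.ofReal (Real.exp (t * x)) ∂μ ≤
          ENNReal.ofReal (Real.exp (t ^ 2 / 2 + η))) →
        ∀ t, |μ.real (Iic t) - (gaussianReal 0 1).real (Iic t)| ≤ ε := by
  have : NullSingletonClass (gaussianReal 0 1) := nullSingletonClass_gaussianReal one_ne_zero
  obtain ⟨X, κ, hκ, hX⟩ := exists_finset_forall_abs_cdf_sub_le (gaussianReal 0 1) hε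
  by_contra! hcon
  -- Counterexamples are indexed by a finite set of moments and a tolerance 1/(k + 1). Along an
  -- ultrafilter finer than `atTop` every t is eventually among the controlled moments, so all
  -- moments converge.
  have hcon' (i : Finset ℝ × ℕ) := hcon i.1 (1 / ((i.2 : ℝ) + 1)) (by positivity)
  choose μ hμ hclose hfar using hcon'
  set l : Ultrafilter (Finset ℝ × ℕ) := Ultrafilter.of atTop
  have hl : (l : Filter (Finset ℝ × ℕ)) ≤ atTop := Ultrafilter.of_le atTop
  have hη : Tendsto (fun i : Finset ℝ × ℕ => 1 / ((i.2 : ℝ) + 1)) l (𝓝 0) := by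
    have h1 : Tendsto (fun i : Finset ℝ × ℕ => i.2) atTop atTop := by
      rw [← prod_atTop_atTop_eq]; exact tendsto_snd
    exact (tendsto_one_div_add_atTop_nhds_zero_nat.comp h1).mono_left hl
  have hlim (t : ℝ) : Tendsto (fun i => ∫⁻ x, ENNReal.ofReal (Real.exp (t * x)) ∂(μ i)) l
      (𝓝 (ENNReal.ofReal (Real.exp (t ^ 2 / 2)))) := by
    have hc : Continuous fun η : ℝ => ENNReal.ofReal (Real.exp (t ^ 2 / 2 + η)) :=
      ENNReal.continuous_ofReal.comp (by fun_prop)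
    have hc' : Continuous fun η : ℝ => ENNReal.ofReal (Real.exp (t ^ 2 / 2 - η)) :=
      ENNReal.continuous_ofReal.comp (by fun_prop)
    have hF : ∀ᶠ i : Finset ℝ × ℕ in l, t ∈ i.1 := by
      refine hl ?_
      filter_upwards [eventually_ge_atTop (({t}, 0) : Finset ℝ × ℕ)] with i hi
      exact hi.1 (Finset.mem_singleton_self t)
    refine tendsto_of_tendsto_of_tendsto_of_le_of_le'
      (by simpa [Function.comp_def] using (hc'.tendsto 0).comp hη)
      (by simpa [Function.comp_def] using (hc.tendsto 0).comp hη) ?_ ?_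
    · filter_upwards [hF] with i hi using by simpa using (hclose i t hi).1
    · filter_upwards [hF] with i hi using by simpa using (hclose i t hi).2
  have hweak := tendsto_gaussianReal_of_tendsto_lintegral_exp l
    (μ := fun i => ⟨μ i, hμ i⟩) hlim
  have hpt (x : ℝ) : Tendsto (fun i => (μ i).real (Iic x)) l
      (𝓝 ((gaussianReal 0 1).real (Iic x))) := by
    have := ProbabilityMeasure.tendsto_measure_of_null_frontier_of_tendsto' hweak (E := Iic x)
      (by rw [frontier_Iic]; exact measure_singleton (μ := gaussianReal 0 1) x)
    exact (ENNReal.tendsto_toReal (measure_ne_top _ _)).comp this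
  have hev : ∀ᶠ i in (l : Filter (Finset ℝ × ℕ)), ∀ x ∈ X,
      |(μ i).real (Iic x) - (gaussianReal 0 1).real (Iic x)| ≤ κ := by
    rw [X.eventually_all]
    intro x _
    have := (tendsto_iff_norm_sub_tendsto_zero.1 (hpt x)).eventually (gt_mem_nhds hκ)
    filter_upwards [this] with i hi using hi.le
  obtain ⟨i, hi⟩ := hev.exists
  obtain ⟨t, ht⟩ := hfar i
  exact absurd (hX (μ i) hi t) (not_le.2 ht)

end MomentGenerating

/-! ### Conditioning the posterior on a set -/

section NormalizedRestriction

variable {E : Type*} [MeasurableSpace E]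

/-- The law of `T` under the probability measure proportional to `f · ρ` restricted to `A`. -/
noncomputable def conditionalLaw (ρ : Measure E) (f : E → ℝ≥0∞) (A : Set E) (T : E → ℝ) :
    Measure ℝ :=
  ((∫⁻ y in A, f y ∂ρ)⁻¹ • (ρ.restrict A).withDensity f).map T

variable {ρ : Measure E} {f : E → ℝ≥0∞} {A : Set E} {T : E → ℝ}

lemma aemeasurable_normalized_restriction (hT : AEMeasurable T ρ) :
    AEMeasurable T ((∫⁻ y in A, f y ∂ρ)⁻¹ • (ρ.restrict A).withDensity f) :=
  ((hT.mono_measure Measure.restrict_le_self).mono_ac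
    (withDensity_absolutelyContinuous _ _)).smul_measure _

lemma lintegral_conditionalLaw (hf : Measurable f) (hT : AEMeasurable T ρ) {g : ℝ → ℝ≥0∞}
    (hg : Measurable g) :
    ∫⁻ y, g y ∂(conditionalLaw ρ f A T) =
      (∫⁻ y in A, f y * g (T y) ∂ρ) / ∫⁻ y in A, f y ∂ρ := by
  rw [conditionalLaw, lintegral_map' hg.aemeasurable (aemeasurable_normalized_restriction hT),
    lintegral_smul_measure, show (fun y => g (T y)) = g ∘ T from rfl,
    lintegral_withDensity_eq_lintegral_mul₀ hf.aemeasurable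
      (hg.comp_aemeasurable (hT.mono_measure Measure.restrict_le_self)), smul_eq_mul,
    ENNReal.div_eq_inv_mul]
  rfl

lemma conditionalLaw_apply [SFinite ρ] (hT : AEMeasurable T ρ) {s : Set ℝ}
    (hs : MeasurableSet s) (hA : MeasurableSet A) :
    conditionalLaw ρ f A T s =
      (∫⁻ y in (T ⁻¹' s) ∩ A, f y ∂ρ) / ∫⁻ y in A, f y ∂ρ := by
  rw [conditionalLaw, Measure.map_apply_of_aemeasurable (aemeasurable_normalized_restriction hT) hs,
    Measure.smul_apply, withDensity_apply', Measure.restrict_restrict' hA, smul_eq_mul,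
    ENNReal.div_eq_inv_mul]

lemma isProbabilityMeasure_conditionalLaw (hf : Measurable f) (hT : AEMeasurable T ρ)
    (h0 : ∫⁻ y in A, f y ∂ρ ≠ 0) (htop : ∫⁻ y in A, f y ∂ρ ≠ ∞) :
    IsProbabilityMeasure (conditionalLaw ρ f A T) := by
  constructor
  have := lintegral_conditionalLaw (A := A) hf hT (g := fun _ => 1) measurable_const
  simp only [lintegral_const, one_mul, mul_one] at this
  rw [this, ENNReal.div_self h0 htop]

/-- Conditioning on `A` moves the probability of an event by at most the mass missed by `A`. -/
lemma abs_sub_conditionalLaw_le [SFinite ρ] (hT : AEMeasurable T ρ) (hA : MeasurableSet A)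
    (h0 : ∫⁻ y in A, f y ∂ρ ≠ 0) (htop : ∫⁻ y, f y ∂ρ ≠ ∞) (t : ℝ) :
    |((∫⁻ y in {y | T y ≤ t}, f y ∂ρ) / ∫⁻ y, f y ∂ρ).toReal -
        (conditionalLaw ρ f A T).real (Set.Iic t)| ≤
      |((∫⁻ y in A, f y ∂ρ) / ∫⁻ y, f y ∂ρ).toReal - 1| := by
  rw [measureReal_def, conditionalLaw_apply hT measurableSet_Iic hA]
  change |((∫⁻ y in {y | T y ≤ t}, f y ∂ρ) / ∫⁻ y, f y ∂ρ).toReal -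
        ((∫⁻ y in {y | T y ≤ t} ∩ A, f y ∂ρ) / ∫⁻ y in A, f y ∂ρ).toReal| ≤ _
  set B := {y | T y ≤ t}
  have hB := lintegral_inter_add_sdiff (μ := ρ) f B hA
  have hAc := lintegral_add_compl (μ := ρ) f hA
  have hb1 : ∫⁻ y in B ∩ A, f y ∂ρ ≤ ∫⁻ y in A, f y ∂ρ :=
    lintegral_mono_set Set.inter_subset_right
  have hb2 : ∫⁻ y in B \ A, f y ∂ρ ≤ ∫⁻ y in Aᶜ, f y ∂ρ :=
    lintegral_mono_set fun _ h => h.2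
  rw [← hAc] at htop
  rw [← hB, ← hAc]
  have hafin := ne_top_of_le_ne_top htop le_self_add
  have hcfin := ne_top_of_le_ne_top htop le_add_self
  have hb1fin := ne_top_of_le_ne_top hafin hb1
  have hb2fin := ne_top_of_le_ne_top hcfin hb2
  have hapos := ENNReal.toReal_pos h0 hafin
  have r1 := ENNReal.toReal_mono hafin hb1
  have r2 := ENNReal.toReal_mono hcfin hb2
  simp only [ENNReal.toReal_div, ENNReal.toReal_add hafin hcfin,
    ENNReal.toReal_add hb1fin hb2fin]
  have hc0 : 0 ≤ (∫⁻ y in Aᶜ, f y ∂ρ).toReal := ENNReal.toReal_nonneg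
  have hb10 : 0 ≤ (∫⁻ y in B ∩ A, f y ∂ρ).toReal := ENNReal.toReal_nonneg
  have hb20 : 0 ≤ (∫⁻ y in B \ A, f y ∂ρ).toReal := ENNReal.toReal_nonneg
  generalize (∫⁻ y in A, f y ∂ρ).toReal = a at *
  generalize (∫⁻ y in Aᶜ, f y ∂ρ).toReal = c at *
  generalize (∫⁻ y in B ∩ A, f y ∂ρ).toReal = b₁ at *
  generalize (∫⁻ y in B \ A, f y ∂ρ).toReal = b₂ at *
  have hz : 0 < a + c := by linarith
  -- Both terms on the right lie in [0, c/(a + c)], and c/(a + c) is exactly the mass missed by `A`.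
  have e1 : (b₁ + b₂) / (a + c) - b₁ / a = b₂ / (a + c) - b₁ / a * (c / (a + c)) := by
    field_simp; ring
  have e2 : a / (a + c) - 1 = -(c / (a + c)) := by field_simp; ring
  rw [e1, e2, abs_neg, abs_of_nonneg (by positivity : 0 ≤ c / (a + c)), abs_le]
  have h3 : b₂ / (a + c) ≤ c / (a + c) := by gcongr
  have h4 : b₁ / a ≤ 1 := (div_le_one hapos).2 r1
  have h5 : 0 ≤ b₁ / a := by positivity
  have h6 : 0 ≤ c / (a + c) := by positivity
  have h7 : 0 ≤ b₂ / (a + c) := by positivity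
  constructor <;> nlinarith

/-- If `h ≈ l + t T - t²/2` on `A` and the ratio of the integrals of `exp h` and `exp l` is close
to one, then the exponential moment of `T` at `t` is close to `exp (t²/2)`. -/
lemma exp_moment_conditionalLaw_bounds {l h : E → ℝ} (hl : Measurable l) (hT : AEMeasurable T ρ)
    (hA : MeasurableSet A) {t η : ℝ}
    (hlh : ∀ y ∈ A, |h y - l y - t * T y + t ^ 2 / 2| ≤ η / 2)
    (hratio : |((∫⁻ y in A, ENNReal.ofReal (Real.exp (h y)) ∂ρ) /
      ∫⁻ y in A, ENNReal.ofReal (Real.exp (l y)) ∂ρ).toReal - 1| < 1 - Real.exp (-(η / 2))) :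
    ENNReal.ofReal (Real.exp (t ^ 2 / 2 - η)) ≤ ∫⁻ x, ENNReal.ofReal (Real.exp (t * x))
        ∂(conditionalLaw ρ (fun y => ENNReal.ofReal (Real.exp (l y))) A T) ∧
      ∫⁻ x, ENNReal.ofReal (Real.exp (t * x))
        ∂(conditionalLaw ρ (fun y => ENNReal.ofReal (Real.exp (l y))) A T) ≤
        ENNReal.ofReal (Real.exp (t ^ 2 / 2 + η)) := by
  rw [lintegral_conditionalLaw (by fun_prop) hT (by fun_prop)]
  set Z := ∫⁻ y in A, ENNReal.ofReal (Real.exp (l y)) ∂ρ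
  set N := ∫⁻ y in A, ENNReal.ofReal (Real.exp (h y)) ∂ρ
  set M := ∫⁻ y in A, ENNReal.ofReal (Real.exp (l y)) * ENNReal.ofReal (Real.exp (t * T y)) ∂ρ
  obtain ⟨hr1, hr2⟩ := abs_lt.1 hratio
  have hexp := Real.exp_pos (-(η / 2))
  have hR1 : Real.exp (-(η / 2)) ≤ (N / Z).toReal := by linarith
  -- The ratio is at most 2 − exp(−η/2), and exp(η/2) + exp(−η/2) ≥ 2.
  have hR2 : (N / Z).toReal ≤ Real.exp (η / 2) := by
    have h1 : Real.exp (η / 2) * Real.exp (-(η / 2)) = 1 := by rw [← Real.exp_add]; simp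
    nlinarith [sq_nonneg (Real.exp (η / 2) - 1), Real.exp_pos (η / 2)]
  -- An infinite ratio would have `toReal` equal to 0, against the positive lower bound.
  have hfin : N / Z ≠ ∞ := fun h => by rw [h, ENNReal.toReal_top] at hR1; linarith
  have hle1 : ENNReal.ofReal (Real.exp (-(η / 2))) ≤ N / Z := ENNReal.ofReal_le_of_le_toReal hR1
  have hle2 : N / Z ≤ ENNReal.ofReal (Real.exp (η / 2)) :=
    (ENNReal.le_ofReal_iff_toReal_le hfin (Real.exp_pos _).le).2 hR2
  have hM : M ≤ ENNReal.ofReal (Real.exp (t ^ 2 / 2 + η / 2)) * N := by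
    rw [← lintegral_const_mul' _ _ ENNReal.ofReal_ne_top]
    refine setLIntegral_mono' hA fun y hy => ?_
    rw [← ENNReal.ofReal_mul (Real.exp_pos _).le, ← ENNReal.ofReal_mul (Real.exp_pos _).le,
      ← Real.exp_add, ← Real.exp_add]
    have := (abs_le.1 (hlh y hy)).1
    exact ENNReal.ofReal_le_ofReal (Real.exp_le_exp.2 (by linarith))
  have hN : ENNReal.ofReal (Real.exp (t ^ 2 / 2 - η / 2)) * N ≤ M := by
    rw [← lintegral_const_mul' _ _ ENNReal.ofReal_ne_top]
    refine setLIntegral_mono' hA fun y hy => ?_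
    rw [← ENNReal.ofReal_mul (Real.exp_pos _).le, ← ENNReal.ofReal_mul (Real.exp_pos _).le,
      ← Real.exp_add, ← Real.exp_add]
    have := (abs_le.1 (hlh y hy)).2
    exact ENNReal.ofReal_le_ofReal (Real.exp_le_exp.2 (by linarith))
  constructor
  · calc ENNReal.ofReal (Real.exp (t ^ 2 / 2 - η))
        = ENNReal.ofReal (Real.exp (t ^ 2 / 2 - η / 2)) *
          ENNReal.ofReal (Real.exp (-(η / 2))) := by
          rw [← ENNReal.ofReal_mul (Real.exp_pos _).le, ← Real.exp_add]; ring_nf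
      _ ≤ ENNReal.ofReal (Real.exp (t ^ 2 / 2 - η / 2)) * (N / Z) := by gcongr
      _ ≤ M / Z := by rw [← mul_div_assoc]; gcongr
  · calc M / Z ≤ ENNReal.ofReal (Real.exp (t ^ 2 / 2 + η / 2)) * (N / Z) := by
          rw [← mul_div_assoc]; gcongr
      _ ≤ ENNReal.ofReal (Real.exp (t ^ 2 / 2 + η / 2)) * ENNReal.ofReal (Real.exp (η / 2)) := by
          gcongr
      _ = _ := by
          rw [← ENNReal.ofReal_mul (Real.exp_pos _).le, ← Real.exp_add]; ring_nf

end NormalizedRestriction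

/-! ### The bound for a fixed sample and the final union bound -/

lemma measurable_logLik {n p : ℕ} (x : Sample n p) : Measurable (logLik x) := by
  have hentry (i j : Fin p) : Measurable fun Ω : Matrix (Fin p) (Fin p) ℝ => Ω i j :=
    (measurable_pi_apply (X := fun _ : Fin p => ℝ) j).comp
      (measurable_pi_apply (X := fun _ : Fin p => Fin p → ℝ) i)
  have hdet : Measurable fun Ω : Matrix (Fin p) (Fin p) ℝ => Ω.det := by
    simp only [Matrix.det_apply]
    exact Finset.measurable_fun_sum _ fun σ _ =>
      (Finset.measurable_fun_prod _ fun i _ => hentry _ _).const_smul _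
  have htr : Measurable fun Ω : Matrix (Fin p) (Fin p) ℝ => (Ω * sampleCov x).trace := by
    simp only [Matrix.trace, Matrix.diag_apply, Matrix.mul_apply]
    exact Finset.measurable_fun_sum _ fun i _ => Finset.measurable_fun_sum _ fun j _ =>
      (hentry i j).mul_const _
  exact ((Real.measurable_log.comp hdet).const_mul _).sub (htr.const_mul _)

/-- The normal approximation of the posterior for a fixed sample, in terms of the posterior mass of
`A`, the likelihood ratios at finitely many points and the linearization error on `A`. -/
lemma abs_posteriorProb_sub_gaussian_le {n p : ℕ} (hn : 0 < n) {x : Sample n p}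
    {prior : Measure (Matrix (Fin p) (Fin p) ℝ)} [IsProbabilityMeasure prior]
    {S Φ : Matrix (Fin p) (Fin p) ℝ} (hS : S.PosDef) (hΦ : Φ.IsSymm) (hΦ0 : Φ ≠ 0)
    {φ : Matrix (Fin p) (Fin p) ℝ → ℝ} (hφ : AEMeasurable (fun Ω => φ Ω⁻¹) prior)
    {A : Set (Matrix (Fin p) (Fin p) ℝ)} (hA : MeasurableSet A) (hApos : ∀ Ω ∈ A, Ω.PosDef)
    {d e : ℝ} (hAd : ∀ Ω ∈ A, specNorm (Ω⁻¹ - S) ≤ d) (he : ∀ Ω ∈ A, d * specNorm S⁻¹ ≤ e)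
    (he1 : e ≤ 1) {ε η κ : ℝ} {F : Finset ℝ}
    (hF : ∀ (μ : Measure ℝ) [IsProbabilityMeasure μ],
      (∀ t ∈ F, ENNReal.ofReal (Real.exp (t ^ 2 / 2 - η)) ≤
          ∫⁻ x, ENNReal.ofReal (Real.exp (t * x)) ∂μ ∧
        ∫⁻ x, ENNReal.ofReal (Real.exp (t * x)) ∂μ ≤
          ENNReal.ofReal (Real.exp (t ^ 2 / 2 + η))) →
        ∀ t, |μ.real (Set.Iic t) - (gaussianReal 0 1).real (Set.Iic t)| ≤ ε)
    (hFn : ∀ t ∈ F, 2 * (Real.sqrt 2 * |t|) / Real.sqrt n ≤ 1 / 2)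
    (hFc : ∀ t ∈ F, 8 * (Real.sqrt 2 * |t|) ^ 3 / Real.sqrt n + 3 * e * t ^ 2 / 2 ≤ η / 4)
    (hFκ : ∀ t ∈ F, |t| * κ ≤ η / 4)
    (hlin : ∀ Ω ∈ A, Real.sqrt n * (weightedNorm S Φ)⁻¹ *
      |φ Ω⁻¹ - φ (sampleCov x) - ((Ω⁻¹ - sampleCov x) * Φ).trace| ≤ κ)
    (hpost : |posteriorProb prior x A - 1| ≤ min (1 / 2) ε)
    (hratio : ∀ t ∈ F, |likelihoodRatio prior x A S Φ t - 1| < 1 - Real.exp (-(η / 2))) (t : ℝ) :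
    |posteriorProb prior x {Ω | Real.sqrt n * (φ Ω⁻¹ - φ (sampleCov x)) /
          (Real.sqrt 2 * weightedNorm S Φ) ≤ t} - (gaussianReal 0 1).real (Set.Iic t)| ≤
      2 * ε := by
  set f : Matrix (Fin p) (Fin p) ℝ → ℝ≥0∞ := fun Ω => ENNReal.ofReal (Real.exp (logLik x Ω))
    with hfdef
  have hf : Measurable f := (Real.measurable_exp.comp (measurable_logLik x)).ennreal_ofReal
  set T : Matrix (Fin p) (Fin p) ℝ → ℝ := fun Ω =>
    Real.sqrt n * (φ Ω⁻¹ - φ (sampleCov x)) / (Real.sqrt 2 * weightedNorm S Φ) with hTdef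
  have hT : AEMeasurable T prior := ((hφ.sub_const _).const_mul _).div_const _
  have hw := weightedNorm_pos hS hΦ0
  -- Posterior mass at least 1/2 rules out the default value 0 of `toReal` and of division by
  -- infinity, so the normalizing integral is finite and `A` has positive mass.
  have hratio0 : ((∫⁻ Ω in A, f Ω ∂prior) / ∫⁻ Ω, f Ω ∂prior).toReal ≠ 0 := by
    have h1 := (abs_le.1 (hpost.trans (min_le_left _ _))).1
    change -(1 / 2) ≤ ((∫⁻ Ω in A, f Ω ∂prior) / ∫⁻ Ω, f Ω ∂prior).toReal - 1 at h1
    intro h0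
    rw [h0] at h1
    norm_num at h1
  have hZA : ∫⁻ Ω in A, f Ω ∂prior ≠ 0 := fun h => hratio0 (by simp [h])
  have hZ : ∫⁻ Ω, f Ω ∂prior ≠ ∞ := fun h => hratio0 (by simp [h])
  have hZAtop : ∫⁻ Ω in A, f Ω ∂prior ≠ ∞ :=
    ne_top_of_le_ne_top hZ (setLIntegral_le_lintegral _ _)
  have := isProbabilityMeasure_conditionalLaw (A := A) hf hT hZA hZAtop
  have hclose := hF (conditionalLaw prior f A T) (fun s hs => by
    refine exp_moment_conditionalLaw_bounds (h := fun Ω => logLik x (perturbed n S Φ s Ω))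
      (measurable_logLik x) hT hA (fun Ω hΩ => ?_) (hratio s hs)
    have h1 := abs_logLik_perturbed_sub_le (x := x) hn hS (hApos Ω hΩ) hΦ hΦ0 (hAd Ω hΩ) (he Ω hΩ)
      he1 (hFn s hs)
    set D := φ Ω⁻¹ - φ (sampleCov x) - ((Ω⁻¹ - sampleCov x) * Φ).trace with hD
    -- The functional equals its linearization plus a multiple of the error `D`. The two errors take
    -- η/4 each out of the allowed η/2.
    have hsT : s * T Ω = Real.sqrt n * s / (Real.sqrt 2 * weightedNorm S Φ) *
        ((Ω⁻¹ - sampleCov x) * Φ).trace +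
        s / Real.sqrt 2 * (Real.sqrt n * (weightedNorm S Φ)⁻¹ * D) := by
      rw [hTdef, hD]; field_simp; ring
    have h2 : |s / Real.sqrt 2 * (Real.sqrt n * (weightedNorm S Φ)⁻¹ * D)| ≤ η / 4 := by
      rw [abs_mul, abs_mul, abs_of_nonneg (by positivity :
        0 ≤ Real.sqrt n * (weightedNorm S Φ)⁻¹), abs_div, abs_of_nonneg (Real.sqrt_nonneg 2)]
      have h3 : |s| / Real.sqrt 2 ≤ |s| := div_le_self (abs_nonneg _) (by
        rw [Real.one_le_sqrt]; norm_num)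
      have h4 := hlin Ω hΩ
      have h5 : 0 ≤ Real.sqrt n * (weightedNorm S Φ)⁻¹ * |D| := by positivity
      calc _ ≤ |s| * κ := mul_le_mul h3 h4 h5 (abs_nonneg _)
        _ ≤ _ := hFκ s hs
    have h6 := h1.trans (hFc s hs)
    rw [hsT]
    rw [abs_le] at h2 h6 ⊢
    constructor <;> linarith [h2.1, h2.2, h6.1, h6.2]) t
  have hcond := abs_sub_conditionalLaw_le hT hA hZA hZ t
  calc _ ≤ _ := abs_sub_le _ ((conditionalLaw prior f A T).real (Set.Iic t)) _
    _ ≤ ε + ε := add_le_add (hcond.trans (hpost.trans (min_le_right _ _))) hclose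
    _ = 2 * ε := by ring

lemma IsLittleOP.tendsto_measure_of_pos {E : ℕ → Type*} [∀ n, MeasurableSpace (E n)]
    {P : ∀ n, Measure (E n)} {Y : ∀ n, E n → ℝ} (h : IsLittleOP P fun n x => ENNReal.ofReal (Y n x))
    {κ : ℝ} (hκ : 0 < κ) : Tendsto (fun n => P n {x | κ ≤ Y n x}) atTop (𝓝 0) := by
  refine tendsto_of_tendsto_of_tendsto_of_le_of_le tendsto_const_nhds
    (h (ENNReal.ofReal κ) (ENNReal.ofReal_pos.2 hκ)) (fun _ => zero_le) fun n => ?_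
  exact measure_mono fun x hx => ENNReal.ofReal_le_ofReal hx

end CovBvM

theorem theorem1
    (p : ℕ → ℕ)
    (Sstar : ∀ n, Matrix (Fin (p n)) (Fin (p n)) ℝ)
    (hSstar : ∀ n, (Sstar n).PosDef)
    (hbdd : (fun n => max (specNorm (Sstar n)) (specNorm (Sstar n)⁻¹))
      =O[atTop] (fun _ => (1 : ℝ)))
    (prior : ∀ n, Measure (Matrix (Fin (p n)) (Fin (p n)) ℝ))
    [∀ n, IsProbabilityMeasure (prior n)]
    (hprior : ∀ n, ∀ᵐ Ω ∂(prior n), Ω.PosDef)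
    (φ : ∀ n, Matrix (Fin (p n)) (Fin (p n)) ℝ → ℝ)
    (hφ : ∀ n, AEMeasurable (fun Ω => φ n Ω⁻¹) (prior n))
    (Φ : ∀ n, Matrix (Fin (p n)) (Fin (p n)) ℝ)
    (hΦsymm : ∀ n, (Φ n).IsSymm)
    (hΦne : ∀ n, Φ n ≠ 0)
    (A : ∀ n, Set (Matrix (Fin (p n)) (Fin (p n)) ℝ))
    (hAmeas : ∀ n, MeasurableSet (A n))
    (hApos : ∀ n, ∀ Ω ∈ A n, Ω.PosDef)
    (δ : ℕ → ℝ) (hδ : Tendsto δ atTop (𝓝 0))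
    (hAδ : ∀ n, ∀ Ω ∈ A n, specNorm (Ω⁻¹ - Sstar n) ≤ δ n)
    (hlin : IsLittleOP (fun n => sampleLaw n (Sstar n)) fun n x =>
      ⨆ Ω ∈ A n, ENNReal.ofReal
        (Real.sqrt n * (weightedNorm (Sstar n) (Φ n))⁻¹ *
          |φ n Ω⁻¹ - φ n (sampleCov x) - ((Ω⁻¹ - sampleCov x) * Φ n).trace|))
    (hpost : IsLittleOP (fun n => sampleLaw n (Sstar n)) fun n x =>
      ENNReal.ofReal |posteriorProb (prior n) x (A n) - 1|)
    (hratio : ∀ t : ℝ, IsLittleOP (fun n => sampleLaw n (Sstar n)) fun n x =>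
      ENNReal.ofReal |likelihoodRatio (prior n) x (A n) (Sstar n) (Φ n) t - 1|) :
    IsLittleOP (fun n => sampleLaw n (Sstar n)) fun n x =>
      ⨆ t : ℝ, ENNReal.ofReal
        |posteriorProb (prior n) x
            {Ω | Real.sqrt n * (φ n Ω⁻¹ - φ n (sampleCov x)) /
              (Real.sqrt 2 * weightedNorm (Sstar n) (Φ n)) ≤ t}
          - (gaussianReal 0 1).real (Set.Iic t)| := by
  intro ε hε
  obtain ⟨ε', hε', hε'ε⟩ : ∃ ε' : ℝ, 0 < ε' ∧ ENNReal.ofReal (2 * ε') < ε := by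
    obtain ⟨r, hr0, hr⟩ := ENNReal.lt_iff_exists_nnreal_btwn.1 hε
    refine ⟨r / 2, by simpa using hr0, ?_⟩
    rwa [mul_div_cancel₀ _ two_ne_zero, ENNReal.ofReal_coe_nnreal]
  obtain ⟨F, η, hη, hF⟩ := exists_finset_exp_moments_close ε' hε'
  -- One bound for all points of `F`, positive even when `F` is empty; then κ = η/(4K) gives |t| κ ≤
  -- η/4 on `F`.
  set K : ℝ := 1 + ∑ t ∈ F, |t| with hK
  have hK1 : 0 < K := by positivity
  have hKt : ∀ t ∈ F, |t| ≤ K := fun t ht => by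
    have := Finset.single_le_sum (f := fun t : ℝ => |t|) (fun _ _ => abs_nonneg _) ht
    exact this.trans (by linarith)
  set κ : ℝ := η / (4 * K) with hκdef
  have hκ : 0 < κ := by positivity
  obtain ⟨C, hC⟩ := hbdd.bound
  have he : Tendsto (fun n => |δ n| * |C|) atTop (𝓝 0) := by
    simpa using hδ.abs.mul_const |C|
  have hsqrt : Tendsto (fun n : ℕ => Real.sqrt n) atTop atTop :=
    Real.tendsto_sqrt_atTop.comp tendsto_natCast_atTop_atTop
  have hev1 : ∀ᶠ n : ℕ in atTop, ∀ t ∈ F, 2 * (Real.sqrt 2 * |t|) / Real.sqrt n ≤ 1 / 2 := by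
    rw [F.eventually_all]
    intro t _
    exact (((tendsto_const_nhds (x := 2 * (Real.sqrt 2 * |t|))).div_atTop hsqrt).eventually
      (gt_mem_nhds (by norm_num : (0 : ℝ) < 1 / 2))).mono fun n hn => hn.le
  have hev2 : ∀ᶠ n : ℕ in atTop, ∀ t ∈ F,
      8 * (Real.sqrt 2 * |t|) ^ 3 / Real.sqrt n + 3 * (|δ n| * |C|) * t ^ 2 / 2 ≤ η / 4 := by
    rw [F.eventually_all]
    intro t _
    have h1 := (tendsto_const_nhds (x := 8 * (Real.sqrt 2 * |t|) ^ 3)).div_atTop hsqrt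
    have h2 := ((he.const_mul 3).mul_const (t ^ 2)).div_const 2
    have h3 := h1.add h2
    simp only [mul_zero, zero_mul, zero_div, add_zero] at h3
    exact (h3.eventually (gt_mem_nhds (by positivity : 0 < η / 4))).mono fun n hn => hn.le
  have hexp : 0 < 1 - Real.exp (-(η / 2)) := by
    have : Real.exp (-(η / 2)) < 1 := by rw [Real.exp_lt_one_iff]; linarith
    linarith
  have hκA : 0 < min (1 / 2) ε' := by positivity
  have hsum : Tendsto (fun n =>
      (sampleLaw n (Sstar n) {x | ENNReal.ofReal κ ≤ ⨆ Ω ∈ A n, ENNReal.ofReal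
        (Real.sqrt n * (weightedNorm (Sstar n) (Φ n))⁻¹ *
          |φ n Ω⁻¹ - φ n (sampleCov x) - ((Ω⁻¹ - sampleCov x) * Φ n).trace|)} +
      sampleLaw n (Sstar n) {x | min (1 / 2) ε' ≤ |posteriorProb (prior n) x (A n) - 1|}) +
      ∑ t ∈ F, sampleLaw n (Sstar n) {x | 1 - Real.exp (-(η / 2)) ≤
        |likelihoodRatio (prior n) x (A n) (Sstar n) (Φ n) t - 1|}) atTop (𝓝 0) := by
    have h1 := ((hlin _ (ENNReal.ofReal_pos.2 hκ)).add (hpost.tendsto_measure_of_pos hκA)).add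
      (tendsto_finsetSum F fun t _ => (hratio t).tendsto_measure_of_pos hexp)
    simpa using h1
  refine tendsto_of_tendsto_of_tendsto_of_le_of_le' tendsto_const_nhds hsum
    (Eventually.of_forall fun _ => zero_le) ?_
  filter_upwards [hev1, hev2, hC, he.eventually (gt_mem_nhds one_pos), eventually_gt_atTop 0]
    with n h1 h2 hCn hen hn
  -- Outside the bad events the bound for a fixed sample applies, so the failure event lies in their
  -- union. Subadditivity holds for outer measure, so none of these sets need be measurable.
  refine le_trans (measure_mono ?_) ((measure_union_le _ _).trans
    (add_le_add (measure_union_le _ _) (measure_biUnion_finset_le F _)))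
  intro x hx
  by_contra hgood
  simp only [Set.mem_union, Set.mem_iUnion, not_or, not_exists, Set.mem_ofPred_eq, not_le] at hgood
  obtain ⟨⟨hg1, hg2⟩, hg3⟩ := hgood
  refine absurd hx (not_le.2 (lt_of_le_of_lt (iSup_le fun t => ENNReal.ofReal_le_ofReal ?_) hε'ε))
  refine abs_posteriorProb_sub_gaussian_le hn (hSstar n) (hΦsymm n) (hΦne n) (hφ n) (hAmeas n)
    (hApos n) (hAδ n) (fun Ω _ => ?_) hen.le hF h1 h2 (κ := κ) (fun t ht => ?_)
    (fun Ω hΩ => ?_) hg2.le (fun t ht => hg3 t ht) t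
  · have h3 : specNorm (Sstar n)⁻¹ ≤ |C| := by
      rw [norm_one, mul_one, Real.norm_eq_abs] at hCn
      exact (le_max_right _ _).trans ((le_abs_self _).trans (hCn.trans (le_abs_self _)))
    have h4 : 0 ≤ specNorm (Sstar n)⁻¹ := norm_nonneg _
    exact mul_le_mul (le_abs_self _) h3 h4 (abs_nonneg _)
  · calc |t| * κ ≤ K * κ := by gcongr; exact hKt t ht
      _ = η / 4 := by rw [hκdef]; field_simp
  · have h5 := (le_iSup₂ (f := fun Ω (_ : Ω ∈ A n) => ENNReal.ofReal
      (Real.sqrt n * (weightedNorm (Sstar n) (Φ n))⁻¹ *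
        |φ n Ω⁻¹ - φ n (sampleCov x) - ((Ω⁻¹ - sampleCov x) * Φ n).trace|)) Ω hΩ).trans hg1.le
    exact (ENNReal.ofReal_le_ofReal_iff hκ.le).1 h5
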